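/- **Theorem.** Let $X$ be a separable real Banach space, and let $T_n=\{\emptyset\}\cup\bigcup_{k=1}^n\mathbb N^k$ be the countably branching tree of height $n$. Let $|s|$ be the length of $s \in T_n$, and let $s_{|i}$ be its initial segment of length $i$. Assume that the dual $X^*$ has the following property $(*)$: there is $\varepsilon>0$ such that for every $n\ge 1$ there is a family $(x^*_s)_{s\in T_n}$ in $X^*$ with - $\text{w}^*\text{-}\lim_{k\to\infty} x^*_{t\smallfrown k}=0$ for every $t\in T_n$ with $|t|<n$, - $\|x^*_\emptyset\|\le 1$, and $\|x^*_s\|\ge\varepsilon$ for every $s\in T_n\setminus\{\emptyset\}$, - $\bigl\|x^*_\emptyset+\sum_{i=1}^n\varepsilon_i x^*_{s_{|i}}\bigr\|\le 1$ for every $s\in T_n$ with $|s|=n$ and all $\varepsilon_1,\dots,\varepsilon_n\in\{-1,1\}$. Then the following two assertions hold. 1. For every $n\ge1$, $\ell_\infty^n$ is in the $n$-th weak$^*$ asymptotic structure of $X^*$. That is, for every $\varepsilon>0$, $$\forall X_1\ \exists x_1^*\in S_{X_1}\ \cdots\ \forall X_n\ \exists x_n^*\in S_{X_n}:\quad (x_i^*)_{i=1}^n\text{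 is }(1+\varepsilon)\text{-equivalent to the unit vector basis of }\ell_\infty^n,$$ where each $X_i$ runs through the weak$^*$ closed subspaces of finite codimension of $X^*$ and $S_{X_i}$ is the unit sphere of $X_i$. Here $(x_i)_{i=1}^n$ is $C$-equivalent to $(e_i)_{i=1}^n$ if there are $A,B>0$ with $AB\le C$ such that $\frac1A\|\sum a_ie_i\|\le\|\sum a_ix_i\|\le B\|\sum a_ie_i\|$ for all $a_1,\dots,a_n\in\mathbb R$. 2. For every $\varepsilon>0$, every non-trivial countably branching bundle graph $G$, with its graph distance $d_G$ on the vertex set, embeds into $X^*$ with distortion less than $6+\varepsilon$. That is, there are a map $f:G\to X^*$ and constants $a>0$, $b$ with $b/a<6+\varepsilon$ such that $a\,d_G(x,y)\le\|f(x)-f(y)\|\le b\,d_G(x,y)$ for all vertices $x,y$ of $G$. A countably branching bundle graph is a graph with two distinguished vertices (top and bottom) that is formed from paths of length $1$ by finitely many operations of two kinds. In a *parallel composition* of two such graphs, the top of the first is identified with the bottom of the second; the bottom of the first is the new bottom and the top of the second is the new top. In a *series composition*, countably infinitely many copies of one such graph are taken, and all their tops are identified with each other, as are all their bottoms. The bundle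 graph is non-trivial if at least one series composition is used. -/

import Mathlib

open Filter Topology

universe u v w

/-! ### Weak-star asymptotic structure of a dual space -/

section Banach

variable (X : Type u) [NormedAddCommGroup X] [NormedSpace ℝ X]

/-- `Y` is a weak-star closed subspace of finite codimension of the dual of `X`. -/
def IsWeakStarClosedFiniteCodim (Y : Submodule ℝ (StrongDual ℝ X)) : Prop :=
  IsClosed (StrongDual.toWeakDual '' (Y : Set (StrongDual ℝ X))) ∧
    FiniteDimensional ℝ (StrongDual ℝ X ⧸ Y)

/-- The statement `∀ X₁, ∃ x₁ ∈ S_{X₁}, …, ∀ Xₙ, ∃ xₙ ∈ S_{Xₙ}, P (x₁, …, xₙ)`, where each `Xᵢ`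
runs through the weak-star closed subspaces of finite codimension of the dual of `X`, and where
`S_{Xᵢ}` is the unit sphere of `Xᵢ`. -/
def WeakStarGame : (n : ℕ) → ((Fin n → StrongDual ℝ X) → Prop) → Prop
  | 0, P => P Fin.elim0
  | n + 1, P => ∀ Y : Submodule ℝ (StrongDual ℝ X), IsWeakStarClosedFiniteCodim X Y →
      ∃ x ∈ Y, ‖x‖ = 1 ∧ WeakStarGame n (fun v => P (Fin.cons x v))

/-- Two finite sequences `x` and `y` in normed spaces are `C`-equivalent: there are `A, B > 0`
with `A * B ≤ C` such that `A⁻¹ ‖∑ aᵢ yᵢ‖ ≤ ‖∑ aᵢ xᵢ‖ ≤ B ‖∑ aᵢ yᵢ‖` for all scalars `aᵢ`. -/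
def AreEquivalent {E F : Type*} [NormedAddCommGroup E] [NormedSpace ℝ E]
    [NormedAddCommGroup F] [NormedSpace ℝ F] (C : ℝ) {n : ℕ} (x : Fin n → E) (y : Fin n → F) :
    Prop :=
  ∃ A B : ℝ, 0 < A ∧ 0 < B ∧ A * B ≤ C ∧ ∀ a : Fin n → ℝ,
    A⁻¹ * ‖∑ i, a i • y i‖ ≤ ‖∑ i, a i • x i‖ ∧ ‖∑ i, a i • x i‖ ≤ B * ‖∑ i, a i • y i‖

/-- The `n`-dimensional space `E` with basis `e` is in the `n`-th weak-star asymptotic structure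
of the dual of `X` up to the constant `C`. -/
def InWeakStarAsymptoticStructureUpTo {E : Type*} [NormedAddCommGroup E] [NormedSpace ℝ E]
    {n : ℕ} (e : Module.Basis (Fin n) ℝ E) (C : ℝ) : Prop :=
  ∀ ε : ℝ, 0 < ε → WeakStarGame X n (fun x => AreEquivalent (C * (1 + ε)) x e)

/-- The `n`-dimensional space `E` with basis `e` is in the `n`-th weak-star asymptotic structure
of the dual of `X`. -/
def InWeakStarAsymptoticStructure {E : Type*} [NormedAddCommGroup E] [NormedSpace ℝ E]
    {n : ℕ} (e : Module.Basis (Fin n) ℝ E) : Prop :=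
  InWeakStarAsymptoticStructureUpTo X e 1

/-! ### Weak-star null trees and property (*) -/

/-- The family `x`, restricted to the countably branching tree `T_n` of all finite sequences of
natural numbers of length at most `n`, is weak-star null: along the immediate successors of any
sequence of length less than `n` it tends weak-star to `0`. -/
def IsWeakStarNullTree (n : ℕ) (x : List ℕ → StrongDual ℝ X) : Prop :=
  ∀ t : List ℕ, t.length < n →
    Tendsto (fun k : ℕ => StrongDual.toWeakDual (x (t ++ [k]))) atTop (𝓝 0)

/-- Property (*) of the dual of `X`. The values of `x` at sequences of length larger than `n`
are irrelevant, so that `x` stands for a family indexed by `T_n`. -/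
def PropertyStar : Prop :=
  ∃ ε : ℝ, 0 < ε ∧ ∀ n : ℕ, 1 ≤ n → ∃ x : List ℕ → StrongDual ℝ X,
    IsWeakStarNullTree X n x ∧
    ‖x []‖ ≤ 1 ∧
    (∀ s : List ℕ, s ≠ [] → s.length ≤ n → ε ≤ ‖x s‖) ∧
    ∀ s : List ℕ, s.length = n → ∀ θ : Fin n → ℝ, (∀ i, θ i = 1 ∨ θ i = -1) →
      ‖x [] + ∑ i : Fin n, θ i • x (s.take (i.val + 1))‖ ≤ 1

end Banach

/-! ### Countably branching bundle graphs -/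

/-- A graph with two distinguished vertices, the top and the bottom. Parallel edges, which do not
affect the graph distance, are not distinguished. -/
structure TopBottomGraph where
  V : Type v
  graph : SimpleGraph V
  top : V
  bottom : V

namespace TopBottomGraph

/-- The path of length `1`. -/
def path : TopBottomGraph.{0} where
  V := Bool
  graph := ⊤
  top := true
  bottom := false

/-- The identification of the top of `G` with the bottom of `H` in the disjoint union. -/
def parallelSetoid (G H : TopBottomGraph.{v}) : Setoid (G.V ⊕ H.V) where
  r x y := x = y ∨
    ((x = Sum.inl G.top ∨ x = Sum.inr H.bottom) ∧ (y = Sum.inl G.top ∨ y = Sum.inr H.bottom))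
  iseqv :=
    { refl := fun _ => Or.inl rfl
      symm := by
        rintro x y (h | h)
        · exact Or.inl h.symm
        · exact Or.inr ⟨h.2, h.1⟩
      trans := by
        rintro x y z (rfl | h) (rfl | h')
        · exact Or.inl rfl
        · exact Or.inr h'
        · exact Or.inr h
        · exact Or.inr ⟨h.1, h'.2⟩ }

/-- Parallel composition: the top of `G` is identified with the bottom of `H`. The new bottom is
the bottom of `G` and the new top is the top of `H`. -/
def parallel (G H : TopBottomGraph.{v}) : TopBottomGraph.{v} where
  V := Quotient (parallelSetoid G H)
  graph := (G.graph.sum H.graph).map (Quotient.mk (parallelSetoid G H))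
  top := Quotient.mk _ (Sum.inr H.top)
  bottom := Quotient.mk _ (Sum.inl G.bottom)

/-- The disjoint union of countably infinitely many copies of the graph of `G`. -/
def copies (G : TopBottomGraph.{v}) : SimpleGraph (ℕ × G.V) where
  Adj p q := p.1 = q.1 ∧ G.graph.Adj p.2 q.2
  symm := ⟨fun _ _ h => ⟨h.1.symm, h.2.symm⟩⟩
  loopless := ⟨fun _ h => h.2.ne rfl⟩

/-- The identification of all the tops with each other and of all the bottoms with each other in
the disjoint union of countably many copies of `G`. -/
def seriesSetoid (G : TopBottomGraph.{v}) : Setoid (ℕ × G.V) where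
  r p q := p = q ∨ (p.2 = q.2 ∧ (p.2 = G.top ∨ p.2 = G.bottom))
  iseqv :=
    { refl := fun _ => Or.inl rfl
      symm := by
        rintro p q (h | ⟨h, h'⟩)
        · exact Or.inl h.symm
        · exact Or.inr ⟨h.symm, h ▸ h'⟩
      trans := by
        rintro p q r (rfl | h) (rfl | h')
        · exact Or.inl rfl
        · exact Or.inr h'
        · exact Or.inr h
        · exact Or.inr ⟨h.1.trans h'.1, h.2⟩ }

/-- Series composition: countably infinitely many copies of `G` are glued together along their
tops and along their bottoms. -/
def series (G : TopBottomGraph.{v}) : TopBottomGraph.{v} where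
  V := Quotient (seriesSetoid G)
  graph := G.copies.map (Quotient.mk (seriesSetoid G))
  top := Quotient.mk _ (0, G.top)
  bottom := Quotient.mk _ (0, G.bottom)

/-- An isomorphism of top-bottom graphs: a graph isomorphism that respects top and bottom. -/
structure Iso (G : TopBottomGraph.{v}) (H : TopBottomGraph.{w}) where
  toIso : G.graph ≃g H.graph
  map_top : toIso G.top = H.top
  map_bottom : toIso G.bottom = H.bottom

/-- A finite sequence of operations that forms a countably branching bundle graph out of paths of
length `1`. -/
inductive Construction
  | path : Construction
  | parallel : Construction → Construction → Construction
  | series : Construction → Construction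

/-- The top-bottom graph that results from a construction. -/
def Construction.result : Construction → TopBottomGraph.{0}
  | .path => TopBottomGraph.path
  | .parallel c d => TopBottomGraph.parallel c.result d.result
  | .series c => TopBottomGraph.series c.result

/-- The construction uses at least one series composition. -/
def Construction.UsesSeries : Construction → Prop
  | .path => False
  | .parallel c d => c.UsesSeries ∨ d.UsesSeries
  | .series _ => True

/-- `G` is a non-trivial countably branching bundle graph. -/
def IsNontrivialCountablyBranchingBundleGraph (G : TopBottomGraph.{v}) : Prop :=
  ∃ c : Construction, c.UsesSeries ∧ Nonempty (Iso G c.result)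

/-- The vertex set of `G`, with the graph distance, admits a bi-Lipschitz embedding of distortion
less than `D` into the normed space `E`. (Bundle graphs are connected, so that `SimpleGraph.dist`
is the graph distance.) -/
def EmbedsWithDistortionLT (G : TopBottomGraph.{v}) (E : Type*) [NormedAddCommGroup E] (D : ℝ) :
    Prop :=
  ∃ (f : G.V → E) (a b : ℝ), 0 < a ∧ b / a < D ∧ ∀ x y : G.V,
    a * (G.graph.dist x y : ℝ) ≤ dist (f x) (f y) ∧
      dist (f x) (f y) ≤ b * (G.graph.dist x y : ℝ)

end TopBottomGraph

/-! ### The cube hull of a finite sequence -/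

section CubeHull

variable {E : Type*} [NormedAddCommGroup E] [NormedSpace ℝ E]

/-! Read the asymptotic structure as a game: the first player picks weak-star closed subspaces of
finite codimension, the second answers with unit vectors in them. Everything rests on upper `ℓ_∞`
estimates, i.e. norm bounds on combinations with coefficients in `[-1, 1]`.

Property (*) lets the second player follow a branch of a null tree up to small errors, so some `K`
bounds the cube hull in games of every length (`PropertyStar.exists_uniform`). James' blocking
argument improves `K` to `1 + δ`: if the bound `1 + δ` could not be kept in `m` moves, the first
player could force blocks of length `m` containing vectors of norm above `1 + δ`, and playing the
normalized blocks would divide `K` by `1 + δ` arbitrarily often (`listGame_cubeBound_of_uniform`).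
For unit vectors the upper estimate `1 + δ` implies the lower estimate `1 - δ`, which is assertion
1.

For assertion 2, such plays are arranged into a tree of vectors `x s`, each vanishing on a finite
set that almost norms the span of the earlier ones. Partial sums are then almost contractive, and
each coordinate is at most `2 / (1 - δ)` times the norm (`PropertyStar.exists_tree`). A bundle graph
has coordinates indexed by such a tree (`IsCoding`): along an edge they change by at most `1`, and
only on one branch, while some coordinate separates two vertices by a third of their distance. Using
them as coefficients of the `x s` gives distortion at most `3 * 2 * (1 + δ) / (1 - δ)`. -/

/-- The set of all linear combinations of the members of a list with coefficients in `[-1, 1]`. -/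
def cubeHull : List E → Set E
  | [] => {0}
  | x :: l => {z | ∃ a : ℝ, |a| ≤ 1 ∧ ∃ w ∈ cubeHull l, z = a • x + w}

theorem zero_mem_cubeHull (l : List E) : (0 : E) ∈ cubeHull l := by
  induction l with
  | nil => rfl
  | cons x l ih => exact ⟨0, by simp, 0, ih, by simp⟩

theorem smul_mem_cubeHull {r : ℝ} (hr : |r| ≤ 1) {l : List E} :
    ∀ {z : E}, z ∈ cubeHull l → r • z ∈ cubeHull l := by
  induction l with
  | nil => rintro z rfl; simp [cubeHull]
  | cons x l ih =>
    rintro z ⟨a, ha, w, hw, rfl⟩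
    refine ⟨r * a, ?_, r • w, ih hw, by rw [smul_add, mul_smul]⟩
    rw [abs_mul]
    exact mul_le_one₀ hr (abs_nonneg _) ha

theorem add_mem_cubeHull_append {l l' : List E} :
    ∀ {z z' : E}, z ∈ cubeHull l → z' ∈ cubeHull l' → z + z' ∈ cubeHull (l ++ l') := by
  induction l with
  | nil => rintro z z' rfl hz'; simpa using hz'
  | cons x l ih =>
    rintro z z' ⟨a, ha, w, hw, rfl⟩ hz'
    exact ⟨a, ha, w + z', ih hw hz', by rw [add_assoc]⟩

theorem cubeHull_subset_submodule {l : List E} {Y : Submodule ℝ E} :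
    (∀ x ∈ l, x ∈ Y) → ∀ {z : E}, z ∈ cubeHull l → z ∈ Y := by
  induction l with
  | nil => rintro - z rfl; exact Y.zero_mem
  | cons x l ih =>
    rintro h z ⟨a, -, w, hw, rfl⟩
    exact Y.add_mem (Y.smul_mem _ (h x (by simp))) (ih (fun y hy => h y (by simp [hy])) hw)

theorem sum_map_mem_cubeHull {ι : Type*} (x : ι → E) (d : ι → ℝ) (l : List ι)
    (hd : ∀ t ∈ l, |d t| ≤ 1) : (l.map fun t => d t • x t).sum ∈ cubeHull (l.map x) := by
  induction l with
  | nil => simp [cubeHull]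
  | cons t l ih =>
    exact ⟨d t, hd t (by simp), _, ih fun s hs => hd s (by simp [hs]), by simp⟩

theorem mem_cubeHull_ofFn {n : ℕ} {x : Fin n → E} {z : E} :
    z ∈ cubeHull (List.ofFn x) ↔ ∃ a : Fin n → ℝ, (∀ i, |a i| ≤ 1) ∧ z = ∑ i, a i • x i := by
  induction n generalizing z with
  | zero => simp [cubeHull]
  | succ n ih =>
    rw [List.ofFn_succ]
    constructor
    · rintro ⟨a, ha, w, hw, rfl⟩
      obtain ⟨b, hb, rfl⟩ := ih.1 hw
      refine ⟨Fin.cons a b, fun i => ?_, by simp [Fin.sum_univ_succ]⟩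
      refine Fin.cases ?_ ?_ i <;> simp [ha, hb]
    · rintro ⟨a, ha, rfl⟩
      exact ⟨a 0, ha 0, _, ih.2 ⟨fun i => a i.succ, fun i => ha _, rfl⟩, Fin.sum_univ_succ _⟩

/-- The norm is bounded by `C` on the cube hull of `l`. -/
def CubeBound (C : ℝ) (l : List E) : Prop := ∀ z ∈ cubeHull l, ‖z‖ ≤ C

theorem CubeBound.left {C : ℝ} {l l' : List E} (h : CubeBound C (l ++ l')) : CubeBound C l :=
  fun z hz => h z (by simpa using add_mem_cubeHull_append hz (zero_mem_cubeHull l'))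

/-- Averaging the estimates for `θ` and `-θ` cancels the root `x₀`. The cube is the convex hull of
its sign vectors, so convexity of the ball does the rest. -/
theorem norm_sum_le_one_of_signs {n : ℕ} (x₀ : E) (x : Fin n → E)
    (h : ∀ θ : Fin n → ℝ, (∀ i, θ i = 1 ∨ θ i = -1) → ‖x₀ + ∑ i, θ i • x i‖ ≤ 1)
    {a : Fin n → ℝ} (ha : ∀ i, |a i| ≤ 1) : ‖∑ i, a i • x i‖ ≤ 1 := by
  have heq : {a : Fin n → ℝ | ‖∑ i, a i • x i‖ ≤ 1} =
      Fintype.linearCombination ℝ x ⁻¹' Metric.closedBall 0 1 := by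
    ext a
    rw [Set.mem_preimage, mem_closedBall_zero_iff]
    rfl
  have hconv : Convex ℝ {a : Fin n → ℝ | ‖∑ i, a i • x i‖ ≤ 1} := by
    rw [heq]
    exact (convex_closedBall (0 : E) 1).linear_preimage _
  have hmem : a ∈ convexHull ℝ (Set.univ.pi fun _ : Fin n => ({1, -1} : Set ℝ)) := by
    rw [convexHull_pi]
    intro i _
    rw [convexHull_pair, segment_symm, segment_eq_Icc (by norm_num)]
    exact abs_le.1 (ha i)
  refine convexHull_min (fun θ hθ => ?_) hconv hmem
  have hθ' : ∀ i, θ i = 1 ∨ θ i = -1 := fun i => by simpa using hθ i trivial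
  have h1 := h θ hθ'
  have h2 := h (fun i => - θ i) fun i => by rcases hθ' i with h | h <;> simp [h]
  simp only [neg_smul, Finset.sum_neg_distrib] at h2
  rw [Set.mem_ofPred_eq]
  set y := ∑ i, θ i • x i
  have h4 : (2 : ℝ) • y = (x₀ + y) - (x₀ + -y) := by rw [two_smul]; abel
  have h5 := norm_sub_le (x₀ + y) (x₀ + -y)
  rw [← h4, norm_smul, Real.norm_of_nonneg zero_le_two] at h5
  linarith

end CubeHull

/-! ### The game with lists -/

section Game

variable {X : Type u} [NormedAddCommGroup X] [NormedSpace ℝ X]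

theorem IsWeakStarClosedFiniteCodim.top : IsWeakStarClosedFiniteCodim X ⊤ := by
  refine ⟨?_, inferInstance⟩
  rw [Submodule.top_coe, Set.image_univ_of_surjective StrongDual.toWeakDual.surjective]
  exact isClosed_univ

theorem IsWeakStarClosedFiniteCodim.inf {Y Z : Submodule ℝ (StrongDual ℝ X)}
    (hY : IsWeakStarClosedFiniteCodim X Y) (hZ : IsWeakStarClosedFiniteCodim X Z) :
    IsWeakStarClosedFiniteCodim X (Y ⊓ Z) := by
  refine ⟨?_, Submodule.CoFG.inf (R := ℝ) hY.2 hZ.2⟩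
  rw [Submodule.coe_inf, Set.image_inter StrongDual.toWeakDual.injective]
  exact hY.1.inter hZ.1

/-- The elements of the dual of `X` that vanish on a set. -/
def weakStarAnnihilator (A : Set X) : Submodule ℝ (StrongDual ℝ X) where
  carrier := {x | ∀ a ∈ A, x a = 0}
  zero_mem' := fun _ _ => rfl
  add_mem' := fun hx hy a ha => by simp [hx a ha, hy a ha]
  smul_mem' := fun c x hx a ha => by simp [hx a ha]

theorem isWeakStarClosedFiniteCodim_weakStarAnnihilator {A : Set X} (hA : A.Finite) :
    IsWeakStarClosedFiniteCodim X (weakStarAnnihilator A) := by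
  constructor
  · have : StrongDual.toWeakDual '' (weakStarAnnihilator A : Set (StrongDual ℝ X)) =
        ⋂ a ∈ A, {x : WeakDual ℝ X | x a = 0} := by
      ext x
      rw [Set.mem_iInter₂]
      constructor
      · rintro ⟨y, hy, rfl⟩ a ha
        exact hy a ha
      · intro h
        exact ⟨WeakDual.toStrongDual x, fun a ha => h a ha, rfl⟩
    rw [this]
    exact isClosed_biInter fun a _ => isClosed_eq (WeakDual.eval_continuous a) continuous_const
  · have := hA.to_subtype
    let φ : StrongDual ℝ X →ₗ[ℝ] (A → ℝ) :=
      { toFun := fun x a => x a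
        map_add' := fun _ _ => rfl
        map_smul' := fun _ _ => rfl }
    have hker : weakStarAnnihilator A = LinearMap.ker φ := by
      ext x
      rw [LinearMap.mem_ker, funext_iff, Subtype.forall]
      rfl
    rw [hker]
    exact Submodule.CoFG.ker φ

/-- The game of `WeakStarGame`, with a winning condition on lists. -/
def ListGame : ℕ → (List (StrongDual ℝ X) → Prop) → Prop
  | 0, P => P []
  | n + 1, P => ∀ Y : Submodule ℝ (StrongDual ℝ X), IsWeakStarClosedFiniteCodim X Y →
      ∃ x ∈ Y, ‖x‖ = 1 ∧ ListGame n (fun v => P (x :: v))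

theorem ListGame.mono {n : ℕ} {P Q : List (StrongDual ℝ X) → Prop} (h : ListGame n P)
    (hPQ : ∀ l, P l → Q l) : ListGame n Q := by
  induction n generalizing P Q with
  | zero => exact hPQ _ h
  | succ n ih =>
    intro Y hY
    obtain ⟨x, hx, hx1, hg⟩ := h Y hY
    exact ⟨x, hx, hx1, ih hg fun l => hPQ _⟩

theorem ListGame.and_norm {n : ℕ} {P : List (StrongDual ℝ X) → Prop} (h : ListGame n P) :
    ListGame n (fun l => P l ∧ ∀ x ∈ l, ‖x‖ = 1) := by
  induction n generalizing P with
  | zero => exact ⟨h, by simp⟩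
  | succ n ih =>
    intro Y hY
    obtain ⟨x, hx, hx1, hg⟩ := h Y hY
    refine ⟨x, hx, hx1, (ih hg).mono fun l hl => ⟨hl.1, ?_⟩⟩
    simpa [hx1] using hl.2

theorem ListGame.exists {n : ℕ} {P : List (StrongDual ℝ X) → Prop} (h : ListGame n P) :
    ∃ l, P l := by
  induction n generalizing P with
  | zero => exact ⟨_, h⟩
  | succ n ih =>
    obtain ⟨x, -, -, hg⟩ := h ⊤ .top
    obtain ⟨l, hl⟩ := ih hg
    exact ⟨_, hl⟩

theorem ListGame.weakStarGame {n : ℕ} {P : List (StrongDual ℝ X) → Prop} (h : ListGame n P) :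
    WeakStarGame X n (fun v => P (List.ofFn v)) := by
  induction n generalizing P with
  | zero => simpa [WeakStarGame, ListGame] using h
  | succ n ih =>
    intro Y hY
    obtain ⟨x, hx, hx1, hg⟩ := h Y hY
    refine ⟨x, hx, hx1, ?_⟩
    simpa [List.ofFn_succ] using ih hg

theorem WeakStarGame.mono {n : ℕ} {P Q : (Fin n → StrongDual ℝ X) → Prop}
    (h : WeakStarGame X n P) (hPQ : ∀ v, P v → Q v) : WeakStarGame X n Q := by
  induction n with
  | zero => exact hPQ _ h
  | succ n ih =>
    intro Y hY
    obtain ⟨x, hx, hx1, hg⟩ := h Y hY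
    exact ⟨x, hx, hx1, ih hg fun v => hPQ _⟩

theorem ListGame.of_add {m n : ℕ} {P : List (StrongDual ℝ X) → Prop} (h : ListGame (m + n) P) :
    ListGame m (fun u => ListGame n (fun v => P (u ++ v))) := by
  induction m generalizing P with
  | zero => simpa [ListGame] using h
  | succ m ih =>
    rw [Nat.succ_add] at h
    intro Y hY
    obtain ⟨x, hx, hx1, hg⟩ := h Y hY
    exact ⟨x, hx, hx1, ih hg⟩

/-- A strategy of the first player against `Q` and one of the second player for `P`, played against
each other. -/
theorem ListGame.exists_and_not {m : ℕ} {P Q : List (StrongDual ℝ X) → Prop} (hP : ListGame m P)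
    (hQ : ¬ ListGame m Q) {Y : Submodule ℝ (StrongDual ℝ X)}
    (hY : IsWeakStarClosedFiniteCodim X Y) : ∃ l, (∀ x ∈ l, x ∈ Y) ∧ P l ∧ ¬ Q l := by
  induction m generalizing P Q with
  | zero => exact ⟨[], by simp, hP, hQ⟩
  | succ m ih =>
    simp only [ListGame, not_forall, not_exists, not_and] at hQ
    obtain ⟨Z, hZ, hQ⟩ := hQ
    -- Answering `Y ⊓ Z` keeps the move in `Y` and makes it legal against the winning choice `Z` of
    -- the first player.
    obtain ⟨x, hx, hx1, hg⟩ := hP _ (hY.inf hZ)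
    obtain ⟨l, hl, hPl, hQl⟩ := ih hg (hQ x hx.2 hx1)
    exact ⟨x :: l, by simpa using ⟨hx.1, hl⟩, hPl, hQl⟩

/-- Normalized blocks of length `m` form a sequence of the game of length `n`. -/
theorem ListGame.blocks {m n : ℕ} {D : ℝ} (hD : 0 < D) {P : List (StrongDual ℝ X) → Prop}
    (hP : ListGame (n * m) P) (hm : ¬ ListGame (X := X) m (CubeBound D)) :
    ListGame n (fun ys => ∃ l, P l ∧ ∀ z ∈ cubeHull ys, D • z ∈ cubeHull l) := by
  induction n generalizing P with
  | zero =>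
    rw [Nat.zero_mul] at hP
    exact ⟨[], hP, by rintro z rfl; simp [cubeHull]⟩
  | succ n ih =>
    intro Y hY
    rw [Nat.succ_mul, Nat.add_comm] at hP
    obtain ⟨l, hlY, hg, hl⟩ := hP.of_add.exists_and_not hm hY
    simp only [CubeBound, not_forall, not_le] at hl
    obtain ⟨z, hz, hDz⟩ := hl
    have hz0 : 0 < ‖z‖ := hD.trans hDz
    refine ⟨‖z‖⁻¹ • z, Y.smul_mem _ (cubeHull_subset_submodule hlY hz), ?_, ?_⟩
    · rw [norm_smul, norm_inv, norm_norm, inv_mul_cancel₀ hz0.ne']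
    refine (ih hg).mono ?_
    rintro ys ⟨l', hPl', hl'⟩
    refine ⟨l ++ l', hPl', ?_⟩
    -- Since `D < ‖z‖`, the vector `D • a • ‖z‖⁻¹ • z` is a multiple of `z` by a factor of modulus
    -- at most `1`, so it stays in the cube hull of its block.
    rintro y ⟨a, ha, w, hw, rfl⟩
    rw [smul_add]
    refine add_mem_cubeHull_append ?_ (hl' w hw)
    rw [smul_smul, smul_smul]
    refine smul_mem_cubeHull ?_ hz
    rw [abs_mul, abs_mul, abs_inv, abs_norm, abs_of_pos hD, mul_right_comm]
    refine mul_le_one₀ ?_ (abs_nonneg _) ha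
    rw [← div_eq_mul_inv]
    exact (div_le_one hz0).2 hDz.le

theorem ListGame.cubeBound_div {m n : ℕ} {C D : ℝ} (hD : 0 < D)
    (h : ListGame (X := X) (n * m) (CubeBound C)) (hm : ¬ ListGame (X := X) m (CubeBound D)) :
    ListGame (X := X) n (CubeBound (C / D)) := by
  refine (h.blocks hD hm).mono ?_
  rintro ys ⟨l, hl, hys⟩ z hz
  have := hl _ (hys z hz)
  rw [norm_smul, Real.norm_of_nonneg hD.le] at this
  rwa [le_div_iff₀' hD]

/-- James' argument: a uniform upper `ℓ_∞` bound improves to an almost isometric one. -/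
theorem listGame_cubeBound_of_uniform {K : ℝ}
    (h : ∀ n, ListGame (X := X) n (CubeBound K)) {δ : ℝ} (hδ : 0 < δ) (m : ℕ) :
    ListGame (X := X) m (CubeBound (1 + δ)) := by
  by_contra hm
  -- The bound must hold for all lengths at once, because gaining one factor for length `n` consumes
  -- the bound for length `n * m`.
  have key : ∀ k n : ℕ, ListGame (X := X) n (CubeBound (K / (1 + δ) ^ k)) := by
    intro k
    induction k with
    | zero => simpa using h
    | succ k ih =>
      intro n
      have := (ih (n * m)).cubeBound_div (by positivity) hm
      rwa [div_div, ← pow_succ] at this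
  obtain ⟨k, hk⟩ := pow_unbounded_of_one_lt K (show 1 < 1 + δ by linarith)
  obtain ⟨x, -, hx, hg⟩ := key k 1 ⊤ .top
  have h1 : ‖x‖ ≤ K / (1 + δ) ^ k := hg x ⟨1, by simp, 0, rfl, by simp⟩
  rw [hx, le_div_iff₀ (by positivity), one_mul] at h1
  linarith

end Game

/-! ### Weak-star null trees and the game -/

section Tree

variable {X : Type u} [NormedAddCommGroup X] [NormedSpace ℝ X]

/-- Modulo a weak-star closed subspace of finite codimension, weak-star null sequences become null
in a finite-dimensional Hausdorff space. A linear lift from there is automatically continuous into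
the norm topology. -/
theorem IsWeakStarClosedFiniteCodim.exists_sub_mem_tendsto {Y : Submodule ℝ (StrongDual ℝ X)}
    (hY : IsWeakStarClosedFiniteCodim X Y) {x : ℕ → StrongDual ℝ X}
    (hx : Tendsto (fun k => StrongDual.toWeakDual (x k)) atTop (𝓝 0)) :
    ∃ y : ℕ → StrongDual ℝ X, (∀ k, x k - y k ∈ Y) ∧ Tendsto y atTop (𝓝 0) := by
  let Z : Submodule ℝ (WeakDual ℝ X) := Y.map (StrongDual.toWeakDual (𝕜 := ℝ) (E := X)).toLinearMap
  have hZ : IsClosed (Z : Set (WeakDual ℝ X)) := by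
    rw [Submodule.map_coe]
    exact hY.1
  have hfin : FiniteDimensional ℝ (WeakDual ℝ X ⧸ Z) :=
    have := hY.2
    Module.Finite.equiv (Submodule.Quotient.equiv Y Z StrongDual.toWeakDual rfl)
  obtain ⟨σ, hσ⟩ := Z.mkQ.exists_rightInverse_of_surjective (Submodule.range_mkQ Z)
  let τ : (WeakDual ℝ X ⧸ Z) →ₗ[ℝ] StrongDual ℝ X :=
    (WeakDual.toStrongDual (𝕜 := ℝ) (E := X)).toLinearMap ∘ₗ σ
  have hτ : Continuous τ := LinearMap.continuous_of_finiteDimensional τ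
  have hπ : Continuous Z.mkQ := Submodule.continuous_mkQ Z
  refine ⟨fun k => τ (Z.mkQ (StrongDual.toWeakDual (x k))), fun k => ?_, ?_⟩
  · have h1 : Z.mkQ (StrongDual.toWeakDual (x k) -
        σ (Z.mkQ (StrongDual.toWeakDual (x k)))) = 0 := by
      rw [map_sub, sub_eq_zero]
      exact (LinearMap.congr_fun hσ _).symm
    rw [Submodule.mkQ_apply, Submodule.Quotient.mk_eq_zero] at h1
    obtain ⟨y, hy, hyx⟩ := h1
    have : x k - τ (Z.mkQ (StrongDual.toWeakDual (x k))) = y :=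
      (StrongDual.toWeakDual (𝕜 := ℝ) (E := X)).injective (by rw [map_sub]; exact hyx.symm)
    rwa [this]
  · have := ((hτ.comp hπ).tendsto 0).comp hx
    rwa [Function.comp_apply, map_zero, map_zero] at this

theorem IsWeakStarClosedFiniteCodim.exists_unit_near {Y : Submodule ℝ (StrongDual ℝ X)}
    (hY : IsWeakStarClosedFiniteCodim X Y) {x : ℕ → StrongDual ℝ X}
    (hx : Tendsto (fun k => StrongDual.toWeakDual (x k)) atTop (𝓝 0)) {ε : ℝ} (hε : 0 < ε)
    (hxε : ∀ k, ε ≤ ‖x k‖) {η : ℝ} (hη : 0 < η) :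
    ∃ k, ∃ y ∈ Y, ‖y‖ = 1 ∧ ∃ c : ℝ, |c| ≤ 2 / ε ∧ ‖y - c • x k‖ ≤ η := by
  obtain ⟨y, hyY, hy⟩ := hY.exists_sub_mem_tendsto hx
  -- The first bound keeps `‖x k - y k‖` above `ε / 2`, so normalizing costs at most `2 / ε`; the
  -- second absorbs that factor in the error.
  have hρ : 0 < min (ε / 2) (η * (ε / 2)) := by positivity
  obtain ⟨k, hk⟩ := ((tendsto_zero_iff_norm_tendsto_zero.1 hy).eventually_lt_const hρ).exists
  have hk1 : ‖y k‖ < ε / 2 := hk.trans_le (min_le_left _ _)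
  have hk2 : ‖y k‖ < η * (ε / 2) := hk.trans_le (min_le_right _ _)
  have hn : ε / 2 ≤ ‖x k - y k‖ := by
    have := norm_sub_norm_le (x k) (y k)
    have := hxε k
    linarith
  have hn0 : 0 < ‖x k - y k‖ := by linarith
  have hinv : ‖x k - y k‖⁻¹ ≤ 2 / ε := by
    rw [← inv_div]
    exact inv_anti₀ (by positivity) hn
  refine ⟨k, ‖x k - y k‖⁻¹ • (x k - y k), Y.smul_mem _ (hyY k), ?_, ‖x k - y k‖⁻¹, ?_, ?_⟩
  · rw [norm_smul, norm_inv, norm_norm, inv_mul_cancel₀ hn0.ne']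
  · rwa [abs_of_pos (by positivity)]
  · rw [smul_sub, sub_sub_cancel_left, norm_neg, norm_smul, norm_inv, norm_norm]
    calc ‖x k - y k‖⁻¹ * ‖y k‖ ≤ (2 / ε) * (η * (ε / 2)) := by gcongr
      _ = η := by field_simp

/-- The members of a family indexed by finite sequences at the nonempty initial segments of `s`. -/
def branchList {E : Type*} (x : List ℕ → E) : List ℕ → List E
  | [] => []
  | k :: s => x [k] :: branchList (fun t => x (k :: t)) s

theorem branchList_eq_ofFn {E : Type*} (x : List ℕ → E) (s : List ℕ) :
    branchList x s = List.ofFn (fun i : Fin s.length => x (s.take (i.val + 1))) := by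
  induction s generalizing x with
  | nil => rfl
  | cons k s ih =>
    rw [branchList, ih]
    simp [List.ofFn_succ]

theorem exists_mem_cubeHull_near {E : Type*} [NormedAddCommGroup E] [NormedSpace ℝ E]
    {M η : ℝ} (hM : 0 < M) {l l' : List E}
    (h : List.Forall₂ (fun y w => ∃ c : ℝ, |c| ≤ M ∧ ‖y - c • w‖ ≤ η) l l') :
    ∀ z ∈ cubeHull l, ∃ z' ∈ cubeHull l', ‖z - M • z'‖ ≤ l.length * η := by
  induction h with
  | nil => rintro z rfl; exact ⟨0, rfl, by simp⟩
  | @cons y w l l' h _ ih =>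
    rintro z ⟨a, ha, v, hv, rfl⟩
    obtain ⟨c, hc, hyc⟩ := h
    obtain ⟨v', hv', hvv⟩ := ih v hv
    -- The coefficient `a * c` is only bounded by `M`; dividing by `M` brings it back into `[-1,
    -- 1]`.
    refine ⟨(a * c / M) • w + v', ⟨_, ?_, v', hv', rfl⟩, ?_⟩
    · rw [abs_div, abs_mul, abs_of_pos hM, div_le_one hM]
      nlinarith [abs_nonneg a, abs_nonneg c]
    · have : a • y + v - M • ((a * c / M) • w + v') = a • (y - c • w) + (v - M • v') := by
        rw [smul_add, smul_smul, mul_div_cancel₀ _ hM.ne', mul_smul, smul_sub]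
        abel
      rw [this]
      calc ‖a • (y - c • w) + (v - M • v')‖ ≤ |a| * ‖y - c • w‖ + ‖v - M • v'‖ := by
            refine (norm_add_le _ _).trans_eq ?_
            rw [norm_smul, Real.norm_eq_abs]
        _ ≤ 1 * η + l.length * η := by
            gcongr
        _ = _ := by push_cast [List.length_cons]; ring

theorem IsWeakStarNullTree.listGame {n : ℕ} {x : List ℕ → StrongDual ℝ X}
    (hx : IsWeakStarNullTree X n x) {ε : ℝ} (hε : 0 < ε)
    (hxε : ∀ s : List ℕ, s ≠ [] → s.length ≤ n → ε ≤ ‖x s‖) {η : ℝ} (hη : 0 < η) :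
    ListGame (X := X) n (fun l => ∃ s : List ℕ, s.length = n ∧
      List.Forall₂ (fun y w => ∃ c : ℝ, |c| ≤ 2 / ε ∧ ‖y - c • w‖ ≤ η) l (branchList x s)) := by
  induction n generalizing x with
  | zero => exact ⟨[], rfl, .nil⟩
  | succ n ih =>
    intro Y hY
    have h0 := hx [] (by simp)
    obtain ⟨k, y, hyY, hy1, hc⟩ := hY.exists_unit_near h0 hε
      (fun k => hxε _ (by simp) (by simp)) hη
    refine ⟨y, hyY, hy1, ?_⟩
    refine (ih (x := fun t => x (k :: t)) (fun t ht => hx (k :: t) (by simpa using ht))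
      fun s _ hs => hxε _ (by simp) (by simpa using hs)).mono ?_
    rintro l ⟨s, hs, hl⟩
    exact ⟨k :: s, by simp [hs], .cons hc hl⟩

theorem PropertyStar.exists_uniform (hX : PropertyStar X) :
    ∃ K : ℝ, ∀ n, ListGame (X := X) n (CubeBound K) := by
  obtain ⟨ε, hε, h⟩ := hX
  -- `2 / ε` is the cost of normalizing, `1` the sum of `n` approximation errors of size `1 / n`.
  refine ⟨2 / ε + 1, fun n => ?_⟩
  rcases Nat.eq_zero_or_pos n with rfl | hn
  · rintro z rfl
    rw [norm_zero]
    positivity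
  obtain ⟨x, hnull, -, hxε, hsign⟩ := h n hn
  have hn' : (0 : ℝ) < n := by exact_mod_cast hn
  refine (hnull.listGame hε hxε (η := 1 / n) (by positivity)).mono ?_
  rintro l ⟨s, hs, hl⟩ z hz
  obtain ⟨z', hz', hzz⟩ := exists_mem_cubeHull_near (by positivity) hl z hz
  have hlen : l.length = n := by rw [hl.length_eq, branchList_eq_ofFn, List.length_ofFn, hs]
  have hz1 : ‖z'‖ ≤ 1 := by
    subst hs
    rw [branchList_eq_ofFn] at hz'
    obtain ⟨a, ha, rfl⟩ := mem_cubeHull_ofFn.1 hz'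
    exact norm_sum_le_one_of_signs (x []) _ (fun θ hθ => hsign s rfl θ hθ) ha
  rw [hlen, mul_one_div_cancel hn'.ne'] at hzz
  calc ‖z‖ = ‖(z - (2 / ε) • z') + (2 / ε) • z'‖ := by rw [sub_add_cancel]
    _ ≤ 1 + 2 / ε * ‖z'‖ := by
      refine (norm_add_le _ _).trans (add_le_add hzz ?_)
      rw [norm_smul, Real.norm_of_nonneg (by positivity)]
    _ ≤ 1 + 2 / ε * 1 := by gcongr
    _ = _ := by ring

theorem PropertyStar.listGame (hX : PropertyStar X) {δ : ℝ} (hδ : 0 < δ) (n : ℕ) :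
    ListGame (X := X) n (CubeBound (1 + δ)) :=
  let ⟨_, hK⟩ := hX.exists_uniform
  listGame_cubeBound_of_uniform hK hδ n

/-- Unit vectors with an upper `ℓ_∞` estimate have a lower one. -/
theorem areEquivalent_basisFun {E : Type*} [NormedAddCommGroup E] [NormedSpace ℝ E] {n : ℕ}
    {x : Fin n → E} {δ : ℝ} (hδ : 0 < δ) (hδ1 : δ < 1) (hx : ∀ i, ‖x i‖ = 1)
    (h : CubeBound (1 + δ) (List.ofFn x)) :
    AreEquivalent ((1 + δ) / (1 - δ)) x (Pi.basisFun ℝ (Fin n)) := by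
  have hδ' : 0 < 1 - δ := by linarith
  have hup : ∀ a : Fin n → ℝ, ‖∑ i, a i • x i‖ ≤ (1 + δ) * ‖a‖ := by
    intro a
    rcases eq_or_ne a 0 with rfl | ha
    · simp
    have ha' : 0 < ‖a‖ := norm_pos_iff.2 ha
    have := h _ (mem_cubeHull_ofFn.2 ⟨‖a‖⁻¹ • a, fun i => ?_, rfl⟩)
    · simp only [Pi.smul_apply, smul_assoc, ← Finset.smul_sum] at this
      rwa [norm_smul, norm_inv, norm_norm, inv_mul_le_iff₀ ha', mul_comm] at this
    · rw [Pi.smul_apply, smul_eq_mul, abs_mul, abs_inv, abs_norm, inv_mul_le_one₀ ha']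
      exact norm_le_pi_norm a i
  refine ⟨(1 - δ)⁻¹, 1 + δ, by positivity, by positivity, ?_, fun a => ?_⟩
  · rw [div_eq_inv_mul]
  have hsum : ∑ i, a i • Pi.basisFun ℝ (Fin n) i = a := by
    simpa using (Pi.basisFun ℝ (Fin n)).sum_repr a
  rw [hsum, inv_inv]
  refine ⟨?_, hup a⟩
  rcases isEmpty_or_nonempty (Fin n) with hn | hn
  · simp [Subsingleton.elim a 0]
  obtain ⟨j, hj⟩ : ∃ j, ‖a j‖ = ‖a‖ := by
    obtain ⟨j, hj⟩ := Finite.exists_max fun i => ‖a i‖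
    exact ⟨j, le_antisymm (norm_le_pi_norm a j) ((pi_norm_le_iff_of_nonneg (norm_nonneg _)).2 hj)⟩
  -- Keep the largest coordinate and flip all the others: the two sums add up to `2 * a j` times the
  -- unit vector `x j`, so the upper bound for `b` gives the lower bound for `a`.
  let b : Fin n → ℝ := fun i => if i = j then a j else - a i
  have hb : ‖b‖ ≤ ‖a‖ := by
    refine (pi_norm_le_iff_of_nonneg (norm_nonneg _)).2 fun i => ?_
    by_cases hi : i = j
    · simp [b, hi, ← hj]
    · simpa [b, hi] using norm_le_pi_norm a i
  have hab : ∑ i, a i • x i + ∑ i, b i • x i = (2 * a j) • x j := by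
    rw [← Finset.sum_add_distrib, Finset.sum_eq_single j]
    · simp [b, two_mul, add_smul]
    · intro i _ hi
      simp [b, hi]
    · simp
  have h1 := norm_add_le (∑ i, a i • x i) (∑ i, b i • x i)
  have h2 := (hup b).trans (mul_le_mul_of_nonneg_left hb (by positivity))
  rw [hab, norm_smul, hx, norm_mul, hj, Real.norm_of_nonneg zero_le_two] at h1
  linarith

theorem PropertyStar.inWeakStarAsymptoticStructure (hX : PropertyStar X) (n : ℕ) :
    InWeakStarAsymptoticStructure X (Pi.basisFun ℝ (Fin n)) := by
  intro ε hε
  -- This `δ` solves `(1 + δ) / (1 - δ) = 1 + ε`.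
  have hδ : 0 < ε / (2 + ε) := by positivity
  refine (hX.listGame hδ n).and_norm.weakStarGame.mono fun v hv => ?_
  have hδ1 : ε / (2 + ε) < 1 := by rw [div_lt_one (by positivity)]; linarith
  have := areEquivalent_basisFun hδ hδ1 (fun i => hv.2 _ (by simp [List.mem_ofFn])) hv.1
  convert this using 1
  have : 2 + ε - ε ≠ 0 := by norm_num
  field_simp
  ring

end Tree

/-! ### Trees with branches close to `ℓ_∞` in the dual space -/

section Norming

variable {X : Type u} [NormedAddCommGroup X] [NormedSpace ℝ X]

/-- By compactness of the unit sphere of the span, finitely many points of the unit ball of `X`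
almost norm it; adding a functional that vanishes at these points does not change the values there.
-/
theorem exists_finite_norming {S : Set (StrongDual ℝ X)} (hS : S.Finite) {δ : ℝ} (hδ : 0 < δ) :
    ∃ N : Set X, N.Finite ∧ ∀ u ∈ Submodule.span ℝ S, ∀ v : StrongDual ℝ X,
      (∀ a ∈ N, v a = 0) → (1 - δ) * ‖u‖ ≤ ‖u + v‖ := by
  let F := Submodule.span ℝ S
  have : FiniteDimensional ℝ F := FiniteDimensional.span_of_finite ℝ hS
  have hK : IsCompact {u : F | ‖(u : StrongDual ℝ X)‖ = 1} := by
    have h : {u : F | ‖(u : StrongDual ℝ X)‖ = 1} = Metric.sphere (0 : F) 1 := by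
      ext u
      rw [Metric.mem_sphere, Subtype.dist_eq, ZeroMemClass.coe_zero, dist_zero_right]
      rfl
    rw [h]
    exact isCompact_sphere _ _
  let U : {a : X // ‖a‖ ≤ 1} → Set F := fun a => {u | 1 - δ < ‖(u : StrongDual ℝ X) a‖}
  have hU : ∀ a, IsOpen (U a) := fun a => by
    refine isOpen_lt continuous_const (Continuous.norm ?_)
    exact (ContinuousLinearMap.apply ℝ ℝ (a : X)).continuous.comp continuous_subtype_val
  have hcov : {u : F | ‖(u : StrongDual ℝ X)‖ = 1} ⊆ ⋃ a, U a := by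
    intro u hu
    have hu1 : ‖(u : StrongDual ℝ X)‖ = 1 := hu
    obtain ⟨a, ha, hua⟩ := ContinuousLinearMap.exists_lt_apply_of_lt_opNorm
      (u : StrongDual ℝ X) (show 1 - δ < ‖(u : StrongDual ℝ X)‖ by rw [hu1]; linarith)
    exact Set.mem_iUnion.2 ⟨⟨a, ha.le⟩, hua⟩
  obtain ⟨t, ht⟩ := hK.elim_finite_subcover U hU hcov
  refine ⟨Subtype.val '' (t : Set {a : X // ‖a‖ ≤ 1}), t.finite_toSet.image _, fun u hu v hv => ?_⟩
  rcases eq_or_ne u 0 with rfl | hu0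
  · simp
  have hn : 0 < ‖u‖ := norm_pos_iff.2 hu0
  have hmem : ‖u‖⁻¹ • (⟨u, hu⟩ : F) ∈
      {u : F | ‖(u : StrongDual ℝ X)‖ = 1} := by
    rw [Set.mem_ofPred_eq, Submodule.coe_smul, norm_smul, norm_inv, norm_norm,
      inv_mul_cancel₀ hn.ne']
  obtain ⟨a, hat, hua⟩ := Set.mem_iUnion₂.1 (ht hmem)
  have h1 : 1 - δ < ‖u‖⁻¹ * ‖u a‖ := by simpa [U, norm_smul] using hua
  have h2 : (u + v) a = u a := by
    rw [add_apply, hv a ⟨a, hat, rfl⟩, add_zero]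
  have h3 : ‖(u + v) a‖ ≤ ‖u + v‖ :=
    ((u + v).le_opNorm a).trans (mul_le_of_le_one_right (norm_nonneg _) a.2)
  rw [h2] at h3
  rw [lt_inv_mul_iff₀ hn, mul_comm] at h1
  exact h1.le.trans h3

end Norming

/-- Dependent choice along a rank: the condition at `a` sees only values of smaller rank, and a
choice is guaranteed only once the earlier conditions hold. -/
theorem exists_recursive_choice {α β : Type*} [Nonempty β] (c : α → ℕ)
    (Q : α → (α → β) → β → Prop)
    (hloc : ∀ a f g b, (∀ a', c a' < c a → f a' = g a') → Q a f b → Q a g b)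
    (hstep : ∀ a f, (∀ a', c a' < c a → Q a' f (f a')) → ∃ b, Q a f b) :
    ∃ f : α → β, ∀ a, Q a f (f a) := by
  classical
  -- `Q` expects a total function, so the values already chosen are padded arbitrarily; `hloc` makes
  -- the padding harmless.
  let tr : (a : α) → (∀ a', c a' < c a → β) → α → β := fun a r a' =>
    if h : c a' < c a then r a' h else Classical.arbitrary β
  let f : α → β := (measure c).wf.fix fun a r => Classical.epsilon (Q a (tr a r))
  have hf : ∀ a, f a = Classical.epsilon (Q a (tr a fun a' _ => f a')) := fun a =>
    WellFounded.fix_eq _ _ a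
  refine ⟨f, fun a => ?_⟩
  induction a using (measure c).wf.induction with
  | _ a ih =>
    obtain ⟨b, hb⟩ := hstep a f ih
    have hag : ∀ a', c a' < c a → f a' = tr a (fun a' _ => f a') a' := fun a' h => by
      simp [tr, h]
    have := Classical.epsilon_spec (⟨b, hloc a _ _ b hag hb⟩ : ∃ b, Q a (tr a fun a' _ => f a') b)
    rw [← hf a] at this
    exact hloc a _ _ _ (fun a' h => (hag a' h).symm) this

/-- An enumeration of the finite sequences of natural numbers in which each sequence comes after
its proper initial segments. -/
def seqCode (s : List ℕ) : ℕ := Encodable.encode s.reverse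

theorem seqCode_injective : Function.Injective seqCode := fun _ _ h =>
  List.reverse_injective (Encodable.encode_injective h)

/-- The code of a list exceeds that of its tail; the reversal in `seqCode` turns tails into initial
segments. -/
theorem seqCode_lt_append (s : List ℕ) (k : ℕ) : seqCode s < seqCode (s ++ [k]) := by
  simp only [seqCode, List.reverse_append, List.reverse_singleton, List.singleton_append,
    Encodable.encode_list_cons]
  exact Nat.lt_succ_of_le (Nat.right_le_pair _ _)

theorem inits_append_singleton {α : Type*} (s : List α) (k : α) :
    (s ++ [k]).inits = s.inits ++ [s ++ [k]] := by
  simp [List.inits_append]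

theorem seqCode_lt_of_mem_inits {s t : List ℕ} {k : ℕ} (h : t ∈ s.inits) :
    seqCode t < seqCode (s ++ [k]) := by
  induction s using List.reverseRecOn generalizing k with
  | nil =>
    rw [List.inits, List.mem_singleton] at h
    exact h ▸ seqCode_lt_append [] k
  | append_singleton s j ih =>
    rw [inits_append_singleton, List.mem_append, List.mem_singleton] at h
    rcases h with h | rfl
    · exact (ih h).trans (seqCode_lt_append _ _)
    · exact seqCode_lt_append _ _

theorem nodup_inits {α : Type*} (s : List α) : s.inits.Nodup := by
  induction s with
  | nil => simp
  | cons k s ih =>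
    rw [List.inits_cons, List.nodup_cons]
    exact ⟨by simp, ih.map (List.cons_injective)⟩

section Tree

variable {X : Type u} [NormedAddCommGroup X] [NormedSpace ℝ X]

/-- The members of `x` at the proper initial segments of `s`. -/
def ancestors {E : Type*} (x : List ℕ → E) (s : List ℕ) : List E := s.inits.dropLast.map x

theorem ancestors_append_singleton {E : Type*} (x : List ℕ → E) (s : List ℕ) (k : ℕ) :
    ancestors x (s ++ [k]) = ancestors x s ++ [x s] := by
  induction s using List.reverseRecOn with
  | nil => simp [ancestors]
  | append_singleton s j _ =>
    rw [ancestors, ancestors, inits_append_singleton, inits_append_singleton]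
    simp

theorem ancestors_concat_self {E : Type*} (x : List ℕ → E) (s : List ℕ) :
    ancestors x s ++ [x s] = s.inits.map x := by
  rw [← ancestors_append_singleton x s 0, ancestors, inits_append_singleton, List.dropLast_concat]

theorem ancestors_congr {E : Type*} {x y : List ℕ → E} {s : List ℕ}
    (h : ∀ t, seqCode t < seqCode s → x t = y t) : ancestors x s = ancestors y s := by
  induction s using List.reverseRecOn with
  | nil => rfl
  | append_singleton s j _ =>
    rw [ancestors, ancestors, inits_append_singleton, List.dropLast_concat]
    exact List.map_congr_left fun t ht => h t (seqCode_lt_of_mem_inits ht)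

/-- Vectors are chosen in the order of `seqCode`. Each continues the play along its own branch and
answers the annihilator of the finite sets attached to all vectors chosen before, on whatever
branch. A branch down to length `n` has `n + 1` nodes, the root included, and `l` completes an
unfinished play. -/
theorem exists_tree_of_listGame {n : ℕ} {P : List (StrongDual ℝ X) → Prop}
    (hP : ListGame (n + 1) P) {N : Set (StrongDual ℝ X) → Set X}
    (hN : ∀ S : Set (StrongDual ℝ X), S.Finite → (N S).Finite) :
    ∃ x : List ℕ → StrongDual ℝ X,
      (∀ s : List ℕ, s.length ≤ n → ‖x s‖ = 1 ∧ ∃ l, P (s.inits.map x ++ l)) ∧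
      ∀ s, ∀ m ≤ seqCode s, ∀ a ∈ N (x '' {t | seqCode t < m}), x s a = 0 := by
  have hfin : ∀ (x : List ℕ → StrongDual ℝ X) (m : ℕ), (x '' {t | seqCode t < m}).Finite :=
    fun x m => ((Set.finite_lt_nat m).preimage seqCode_injective.injOn).image _
  obtain ⟨x, hx⟩ : ∃ x : List ℕ → StrongDual ℝ X, ∀ s,
      (s.length ≤ n → ‖x s‖ = 1 ∧ ListGame (n - s.length) fun v => P (ancestors x s ++ x s :: v)) ∧
      ∀ m ≤ seqCode s, ∀ a ∈ N (x '' {t | seqCode t < m}), x s a = 0 := by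
    refine exists_recursive_choice seqCode (fun s (x : List ℕ → StrongDual ℝ X) b =>
      (s.length ≤ n → ‖b‖ = 1 ∧ ListGame (n - s.length) fun v => P (ancestors x s ++ b :: v)) ∧
      ∀ m ≤ seqCode s, ∀ a ∈ N (x '' {t | seqCode t < m}), b a = 0) ?_ ?_
    · intro s x y b hxy hb
      refine ⟨fun hs => ?_, fun m hm a ha => hb.2 m hm a ?_⟩
      · rw [← ancestors_congr hxy]
        exact hb.1 hs
      · have : x '' {t | seqCode t < m} = y '' {t | seqCode t < m} :=
          Set.image_congr fun t ht => hxy t (lt_of_lt_of_le ht hm)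
        rwa [this]
    · intro s x ih
      let A : Set X := ⋃ m ∈ Set.Iic (seqCode s), N (x '' {t | seqCode t < m})
      have hA : A.Finite := (Set.finite_Iic _).biUnion fun m _ => hN _ (hfin x m)
      have hann : ∀ b ∈ weakStarAnnihilator A, ∀ m ≤ seqCode s,
          ∀ a ∈ N (x '' {t | seqCode t < m}), b a = 0 := fun b hb m hm a ha =>
        hb a (Set.mem_biUnion (show m ∈ Set.Iic (seqCode s) from hm) ha)
      rcases lt_or_ge n s.length with hs | hs
      · exact ⟨0, fun h => absurd h hs.not_ge, fun _ _ _ _ => rfl⟩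
      have hg : ListGame (n - s.length + 1) fun v => P (ancestors x s ++ v) := by
        induction s using List.reverseRecOn with
        | nil => simpa [ancestors] using hP
        | append_singleton s k _ =>
          have hs' : s.length < n := by simpa using hs
          have h := ((ih s (seqCode_lt_append s k)).1 hs'.le).2
          rw [ancestors_append_singleton, List.length_append, List.length_singleton,
            show n - (s.length + 1) + 1 = n - s.length by omega]
          simpa using h
      obtain ⟨b, hb, hb1, hbg⟩ := hg _ (isWeakStarClosedFiniteCodim_weakStarAnnihilator hA)
      exact ⟨b, fun _ => ⟨hb1, hbg⟩, hann b hb⟩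
  refine ⟨x, fun s hs => ⟨((hx s).1 hs).1, ?_⟩, fun s => (hx s).2⟩
  obtain ⟨l, hl⟩ := ((hx s).1 hs).2.exists
  exact ⟨l, by rwa [← ancestors_concat_self, List.append_assoc, List.singleton_append]⟩

theorem linearCombination_mem_cubeHull {E : Type*} [NormedAddCommGroup E] [NormedSpace ℝ E]
    (x : List ℕ → E) {s : List ℕ} {d : List ℕ →₀ ℝ} (hd : ∀ t, |d t| ≤ 1)
    (hds : ∀ t, d t ≠ 0 → t <+: s) :
    Finsupp.linearCombination ℝ x d ∈ cubeHull (s.inits.map x) := by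
  have hsub : d.support ⊆ s.inits.toFinset := fun t ht => by
    rw [List.mem_toFinset, List.mem_inits]
    exact hds t (Finsupp.mem_support_iff.1 ht)
  rw [Finsupp.linearCombination_apply, Finsupp.sum_of_support_subset _ hsub _ (by simp),
    List.sum_toFinset _ (nodup_inits s)]
  exact sum_map_mem_cubeHull x d _ fun t _ => hd t

/-- The dual of `X` contains trees of any finite height whose branches have almost isometric upper
`ℓ_∞` estimates and whose coordinates are bounded by almost `2`. -/
theorem PropertyStar.exists_tree (hX : PropertyStar X) {δ : ℝ} (hδ : 0 < δ) (n : ℕ) :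
    ∃ x : List ℕ → StrongDual ℝ X,
      (∀ s : List ℕ, s.length ≤ n → ∀ d : List ℕ →₀ ℝ, (∀ t, |d t| ≤ 1) →
        (∀ t, d t ≠ 0 → t <+: s) → ‖Finsupp.linearCombination ℝ x d‖ ≤ 1 + δ) ∧
      ∀ (d : List ℕ →₀ ℝ) (s : List ℕ), s.length ≤ n →
        (1 - δ) * |d s| ≤ 2 * ‖Finsupp.linearCombination ℝ x d‖ := by
  choose! N hNfin hN using fun (S : Set (StrongDual ℝ X)) (hS : S.Finite) =>
    exists_finite_norming hS hδ
  obtain ⟨x, hx, hann⟩ := exists_tree_of_listGame (hX.listGame hδ (n + 1)) hNfin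
  refine ⟨x, fun s hs d hd hds => ?_, fun d s hs => ?_⟩
  · obtain ⟨l, hl⟩ := (hx s hs).2
    exact hl.left _ (linearCombination_mem_cubeHull x hd hds)
  -- Terms from index `m` on vanish on the set norming the earlier vectors, so truncation at `m` has
  -- norm at most `1 / (1 - δ)` when `δ < 1`.
  have hproj : ∀ m, (1 - δ) * ‖Finsupp.linearCombination ℝ x (d.filter fun t => seqCode t < m)‖ ≤
      ‖Finsupp.linearCombination ℝ x d‖ := by
    intro m
    have hfin : (x '' {t | seqCode t < m}).Finite :=
      ((Set.finite_lt_nat m).preimage seqCode_injective.injOn).image _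
    have := hN _ hfin (Finsupp.linearCombination ℝ x (d.filter fun t => seqCode t < m)) ?_
      (Finsupp.linearCombination ℝ x (d.filter fun t => ¬ seqCode t < m)) ?_
    · rwa [← map_add, Finsupp.filter_add_filter_not] at this
    · rw [Finsupp.linearCombination_apply]
      refine Submodule.sum_mem _ fun t ht => Submodule.smul_mem _ _ (Submodule.subset_span ?_)
      exact ⟨t, (Finset.mem_filter.1 ht).2, rfl⟩
    · intro a ha
      have : ∀ e : List ℕ →₀ ℝ, (∀ t ∈ e.support, ¬ seqCode t < m) →
          Finsupp.linearCombination ℝ x e ∈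
            weakStarAnnihilator (N (x '' {t | seqCode t < m})) := by
        intro e he
        rw [Finsupp.linearCombination_apply]
        exact Submodule.sum_mem _ fun t ht => Submodule.smul_mem _ _
          (hann t m (not_lt.1 (he t ht)))
      refine this _ (fun t ht => ?_) a ha
      rw [Finsupp.support_filter] at ht
      exact (Finset.mem_filter.1 ht).2
  -- A single term is the difference of two consecutive partial sums, whence the factor `2`.
  have hsplit : d.filter (fun t => seqCode t < seqCode s + 1) =
      d.filter (fun t => seqCode t < seqCode s) + Finsupp.single s (d s) := by
    ext t
    rw [Finsupp.add_apply, Finsupp.filter_apply, Finsupp.filter_apply, Finsupp.single_apply]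
    rcases lt_trichotomy (seqCode t) (seqCode s) with h | h | h
    · have : s ≠ t := by rintro rfl; exact h.ne rfl
      simp [h, this, h.trans (Nat.lt_succ_self _)]
    · obtain rfl := seqCode_injective h
      simp
    · have : s ≠ t := by rintro rfl; exact h.ne rfl
      simp [this, h.not_gt, show ¬ seqCode t < seqCode s + 1 by omega]
  have h1 := hproj (seqCode s)
  have h2 := hproj (seqCode s + 1)
  rw [hsplit, map_add, Finsupp.linearCombination_single] at h2
  rcases le_or_gt 1 δ with hδ1 | hδ1
  · have : (1 - δ) * |d s| ≤ 0 := mul_nonpos_of_nonpos_of_nonneg (by linarith) (abs_nonneg _)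
    exact this.trans (by positivity)
  set p := Finsupp.linearCombination ℝ x (d.filter fun t => seqCode t < seqCode s)
  have h3 : ‖d s • x s‖ ≤ ‖p + d s • x s‖ + ‖p‖ := by
    have := norm_sub_le (p + d s • x s) p
    rwa [add_sub_cancel_left] at this
  rw [norm_smul, (hx s hs).1, mul_one, Real.norm_eq_abs] at h3
  nlinarith

end Tree

/-! ### Coordinates on bundle graphs -/

namespace TopBottomGraph

/-- Allowing edges to collapse avoids having to show that the gluing maps keep adjacent vertices
distinct. -/
theorem dist_map_le {V : Type*} {W : Type*} {G : SimpleGraph V} {H : SimpleGraph W}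
    (hG : G.Connected) (f : V → W) (hf : ∀ u v, G.Adj u v → f u = f v ∨ H.Adj (f u) (f v))
    (u v : V) : H.Reachable (f u) (f v) ∧ H.dist (f u) (f v) ≤ G.dist u v := by
  have key : ∀ {u v : V} (p : G.Walk u v), ∃ q : H.Walk (f u) (f v), q.length ≤ p.length := by
    intro u v p
    induction p with
    | nil => exact ⟨.nil, le_rfl⟩
    | cons h p ih =>
      obtain ⟨q, hq⟩ := ih
      rcases hf _ _ h with h | h
      · rw [h]
        exact ⟨q, hq.trans (by simp)⟩
      · exact ⟨.cons h q, by simpa using hq⟩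
  obtain ⟨p, hp⟩ := hG.exists_walk_length_eq_dist u v
  obtain ⟨q, hq⟩ := key p
  exact ⟨⟨q⟩, (SimpleGraph.dist_le q).trans (hp ▸ hq)⟩

/-- A system of coordinates on a top-bottom graph, indexed by finite sequences of length at most
`n`. The coordinate at the empty sequence is the distance from the bottom, the bottom and the top
being at distance `h`. -/
structure IsCoding (G : TopBottomGraph.{v}) (h : ℝ) (n : ℕ) (coef : G.V → List ℕ → ℝ) : Prop where
  connected : G.graph.Connected
  top_nil : coef G.top [] = h
  bottom_nil : coef G.bottom [] = 0
  top_of_ne : ∀ t, t ≠ [] → coef G.top t = 0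
  bottom_of_ne : ∀ t, t ≠ [] → coef G.bottom t = 0
  dist_bottom : ∀ v, (G.graph.dist v G.bottom : ℝ) ≤ coef v []
  dist_top : ∀ v, (G.graph.dist v G.top : ℝ) ≤ h - coef v []
  support : ∀ v, ∃ s : List ℕ, s.length ≤ n ∧ ∀ t, coef v t ≠ 0 → t <+: s
  adj : ∀ u v, G.graph.Adj u v → ∃ s : List ℕ, s.length ≤ n ∧
    ∀ t, |coef u t - coef v t| ≤ 1 ∧ (coef u t ≠ coef v t → t <+: s)
  dist_le : ∀ u v, ∃ t : List ℕ, t.length ≤ n ∧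
    (G.graph.dist u v : ℝ) ≤ 3 * |coef u t - coef v t|

namespace IsCoding

variable {G H : TopBottomGraph.{v}} {h h' : ℝ} {m n : ℕ}

theorem mono {c : G.V → List ℕ → ℝ} (hc : IsCoding G h m c) (hmn : m ≤ n) :
    IsCoding G h n c :=
  { hc with
    support := fun v => (hc.support v).imp fun _ hs => ⟨hs.1.trans hmn, hs.2⟩
    adj := fun u v huv => (hc.adj u v huv).imp fun _ hs => ⟨hs.1.trans hmn, hs.2⟩
    dist_le := fun u v => (hc.dist_le u v).imp fun _ hs => ⟨hs.1.trans hmn, hs.2⟩ }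

theorem nonneg {c : G.V → List ℕ → ℝ} (hc : IsCoding G h n c) (v : G.V) : 0 ≤ c v [] :=
  (Nat.cast_nonneg _).trans (hc.dist_bottom v)

theorem le {c : G.V → List ℕ → ℝ} (hc : IsCoding G h n c) (v : G.V) : c v [] ≤ h :=
  sub_nonneg.1 ((Nat.cast_nonneg _).trans (hc.dist_top v))

theorem path : ∃ c, IsCoding path 1 0 c := by
  have hd : ∀ u v : Bool, ((⊤ : SimpleGraph Bool).dist u v : ℝ) = if u = v then 0 else 1 := by
    intro u v
    rw [SimpleGraph.dist_top]
    split_ifs <;> simp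
  let c : Bool → List ℕ → ℝ := fun v t => if t = [] ∧ v = true then 1 else 0
  have hc : ∀ v t, t ≠ [] → c v t = 0 := fun v t ht => by simp [c, ht]
  exact ⟨c,
    { connected := (SimpleGraph.connected_top : (⊤ : SimpleGraph Bool).Connected)
      top_nil := show c true [] = 1 by simp [c]
      bottom_nil := show c false [] = 0 by simp [c]
      top_of_ne := hc true
      bottom_of_ne := hc false
      dist_bottom := fun v => (hd v false).trans_le (by cases v <;> simp [c])
      dist_top := fun v => (hd v true).trans_le (by cases v <;> simp [c])
      support := fun v => ⟨[], le_rfl, fun t ht => by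
        by_cases ht0 : t = []
        · exact ht0 ▸ List.prefix_rfl
        · exact absurd (hc v t ht0) ht⟩
      adj := fun u v _ => ⟨[], le_rfl, fun t => by
        by_cases ht : t = []
        · subst ht
          refine ⟨?_, fun _ => List.prefix_rfl⟩
          cases u <;> cases v <;> simp [c]
        · simp [hc u t ht, hc v t ht]⟩
      dist_le := fun u v => ⟨[], le_rfl, (hd u v).trans_le (by
        cases u <;> cases v <;> simp [c])⟩ }⟩

/-- The glued vertex lies between the two pieces, so for vertices in different pieces the height
difference alone bounds the distance. Hence both pieces may share the same positions in the tree. -/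
theorem parallel {c : G.V → List ℕ → ℝ} {d : H.V → List ℕ → ℝ} (hc : IsCoding G h n c)
    (hd : IsCoding H h' n d) : ∃ e, IsCoding (parallel G H) (h + h') n e := by
  let e₀ : G.V ⊕ H.V → List ℕ → ℝ :=
    Sum.elim c fun w t => if t = [] then h + d w [] else d w t
  -- Both glued vertices have height `h` and no other nonzero coordinate, so `e₀` descends to the
  -- quotient.
  have hglue : ∀ z, (z = Sum.inl G.top ∨ z = Sum.inr H.bottom) →
      e₀ z = fun t => if t = [] then h else 0 := by
    rintro z (rfl | rfl) <;> funext t <;> by_cases ht : t = []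
    · simp [e₀, ht, hc.top_nil]
    · simp [e₀, ht, hc.top_of_ne]
    · simp [e₀, ht, hd.bottom_nil]
    · simp [e₀, ht, hd.bottom_of_ne]
  let e : (TopBottomGraph.parallel G H).V → List ℕ → ℝ := Quotient.lift e₀ (by
    rintro x y (rfl | ⟨hx, hy⟩)
    · rfl
    · rw [hglue x hx, hglue y hy])
  let il : G.V → (TopBottomGraph.parallel G H).V := fun v => Quotient.mk _ (Sum.inl v)
  let ir : H.V → (TopBottomGraph.parallel G H).V := fun w => Quotient.mk _ (Sum.inr w)
  have hil : ∀ v t, e (il v) t = c v t := fun _ _ => rfl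
  have hir0 : ∀ w, e (ir w) [] = h + d w [] := fun _ => rfl
  have hir : ∀ w t, t ≠ [] → e (ir w) t = d w t := fun w t ht => if_neg ht
  have hirsub : ∀ w w' t, e (ir w) t - e (ir w') t = d w t - d w' t := by
    intro w w' t
    by_cases ht : t = []
    · subst ht
      rw [hir0, hir0, add_sub_add_left_eq_sub]
    · rw [hir w t ht, hir w' t ht]
  have hlr : il G.top = ir H.bottom := Quotient.sound (Or.inr ⟨Or.inl rfl, Or.inr rfl⟩)
  have hcases : ∀ z, (∃ v, il v = z) ∨ ∃ w, ir w = z := by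
    intro z
    induction z using Quotient.inductionOn with
    | _ z => rcases z with v | w; exacts [Or.inl ⟨v, rfl⟩, Or.inr ⟨w, rfl⟩]
  have hl := dist_map_le (H := (TopBottomGraph.parallel G H).graph) hc.connected il
    fun u v huv => or_iff_not_imp_left.2 fun hne =>
      ⟨hne, Sum.inl u, Sum.inl v, SimpleGraph.sum_adj_inl.2 huv, rfl, rfl⟩
  have hr := dist_map_le (H := (TopBottomGraph.parallel G H).graph) hd.connected ir
    fun u v huv => or_iff_not_imp_left.2 fun hne =>
      ⟨hne, Sum.inr u, Sum.inr v, SimpleGraph.sum_adj_inr.2 huv, rfl, rfl⟩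
  have hconn : (TopBottomGraph.parallel G H).graph.Connected := by
    refine SimpleGraph.connected_iff_exists_forall_reachable _ |>.2 ⟨il G.top, fun z => ?_⟩
    rcases hcases z with ⟨v, rfl⟩ | ⟨w, rfl⟩
    · exact (hl _ _).1
    · rw [hlr]
      exact (hr _ _).1
  have hmix : ∀ v w, ((TopBottomGraph.parallel G H).graph.dist (il v) (ir w) : ℝ) ≤
      e (ir w) [] - e (il v) [] := by
    intro v w
    have h1 : ((TopBottomGraph.parallel G H).graph.dist (il v) (ir w) : ℝ) ≤
        (TopBottomGraph.parallel G H).graph.dist (il v) (il G.top) +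
        (TopBottomGraph.parallel G H).graph.dist (ir H.bottom) (ir w) := by
      rw [← hlr]
      exact_mod_cast hconn.dist_triangle
    have h2 : ((TopBottomGraph.parallel G H).graph.dist (il v) (il G.top) : ℝ) ≤
      G.graph.dist v G.top := by exact_mod_cast (hl _ _).2
    have h3 : ((TopBottomGraph.parallel G H).graph.dist (ir H.bottom) (ir w) : ℝ) ≤
      H.graph.dist w H.bottom := by rw [H.graph.dist_comm]; exact_mod_cast (hr _ _).2
    have h4 := hc.dist_top v
    have h5 := hd.dist_bottom w
    rw [hir0, hil]
    linarith
  have hll : ∀ u v, ((TopBottomGraph.parallel G H).graph.dist (il u) (il v) : ℝ) ≤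
      G.graph.dist u v := fun u v => by exact_mod_cast (hl u v).2
  have hrr : ∀ u v, ((TopBottomGraph.parallel G H).graph.dist (ir u) (ir v) : ℝ) ≤
      H.graph.dist u v := fun u v => by exact_mod_cast (hr u v).2
  have hmix' : ∀ v w, ((TopBottomGraph.parallel G H).graph.dist (il v) (ir w) : ℝ) ≤
      3 * |e (ir w) [] - e (il v) []| := fun v w => by
    have := hmix v w
    have := le_abs_self (e (ir w) [] - e (il v) [])
    have := abs_nonneg (e (ir w) [] - e (il v) [])
    linarith
  refine ⟨e,
    { connected := hconn
      top_nil := (hir0 H.top).trans (by rw [hd.top_nil])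
      bottom_nil := hc.bottom_nil
      top_of_ne := fun t ht => (hir H.top t ht).trans (hd.top_of_ne t ht)
      bottom_of_ne := hc.bottom_of_ne
      dist_bottom := fun z => ?_
      dist_top := fun z => ?_
      support := fun z => ?_
      adj := ?_
      dist_le := fun z z' => ?_ }⟩
  · rcases hcases z with ⟨v, rfl⟩ | ⟨w, rfl⟩
    · exact (hll v G.bottom).trans (hc.dist_bottom v)
    · rw [SimpleGraph.dist_comm]
      refine (hmix G.bottom w).trans ?_
      rw [hil, hc.bottom_nil, sub_zero]
  · rcases hcases z with ⟨v, rfl⟩ | ⟨w, rfl⟩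
    · refine (hmix v H.top).trans ?_
      rw [hir0, hd.top_nil]
    · refine (hrr w H.top).trans ?_
      have := hd.dist_top w
      rw [hir0]
      linarith
  · rcases hcases z with ⟨v, rfl⟩ | ⟨w, rfl⟩
    · exact hc.support v
    · obtain ⟨s, hs, hst⟩ := hd.support w
      refine ⟨s, hs, fun t ht => ?_⟩
      by_cases ht0 : t = []
      · exact ht0 ▸ List.nil_prefix
      · exact hst t (hir w t ht0 ▸ ht)
  · rintro z z' ⟨-, x, y, hxy, rfl, rfl⟩
    rcases x with u | u <;> rcases y with v | v
    · exact hc.adj u v (SimpleGraph.sum_adj_inl.1 hxy)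
    · exact absurd hxy (by simp [SimpleGraph.sum])
    · exact absurd hxy (by simp [SimpleGraph.sum])
    · obtain ⟨s, hs, hst⟩ := hd.adj u v (SimpleGraph.sum_adj_inr.1 hxy)
      refine ⟨s, hs, fun t => ?_⟩
      have h1 := hirsub u v t
      refine ⟨(congrArg abs h1).trans_le (hst t).1, fun hne => (hst t).2 ?_⟩
      rw [← sub_ne_zero, ← h1]
      exact sub_ne_zero.2 hne
  · rcases hcases z with ⟨u, rfl⟩ | ⟨u, rfl⟩ <;> rcases hcases z' with ⟨v, rfl⟩ | ⟨v, rfl⟩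
    · obtain ⟨t, ht, htd⟩ := hc.dist_le u v
      exact ⟨t, ht, (hll u v).trans htd⟩
    · refine ⟨[], Nat.zero_le _, ?_⟩
      rw [abs_sub_comm]
      exact hmix' u v
    · refine ⟨[], Nat.zero_le _, ?_⟩
      rw [SimpleGraph.dist_comm]
      exact hmix' v u
    · obtain ⟨t, ht, htd⟩ := hd.dist_le u v
      refine ⟨t, ht, (hrr u v).trans ?_⟩
      rwa [hirsub]

/-- The coordinates on countably many copies of a graph with coordinates `c`: the coordinate at
`[k]` is the distance to the bottom or the top, whichever is smaller, in the copy of number `k`. -/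
def seriesCoef {V : Type*} (h : ℝ) (c : V → List ℕ → ℝ) (p : ℕ × V) : List ℕ → ℝ
  | [] => c p.2 []
  | j :: t => if j = p.1 then (if t = [] then min (c p.2 []) (h - c p.2 []) else c p.2 t) else 0

theorem abs_min_sub_min_le (h a b : ℝ) :
    |min a (h - a) - min b (h - b)| ≤ |a - b| := by
  refine (abs_min_sub_min_le_max _ _ _ _).trans (max_le le_rfl ?_)
  rw [sub_sub_sub_cancel_left, abs_sub_comm]

/-- Height no longer separates different copies, so copy `k` gets the new coordinate `[k]`, its old
non-root coordinates moving below it. The new coordinate vanishes at both ends, which keeps the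
gluing consistent, and is 1-Lipschitz in the height. -/
theorem series {c : G.V → List ℕ → ℝ} (hc : IsCoding G h n c) :
    ∃ e, IsCoding (series G) h (n + 1) e := by
  have h0 : 0 ≤ h := hc.top_nil ▸ hc.nonneg G.top
  have hends : ∀ v k, (v = G.top ∨ v = G.bottom) → ∀ t, t ≠ [] →
      seriesCoef h c (k, v) t = 0 := by
    rintro v k hv (_ | ⟨j, t⟩) ht
    · exact absurd rfl ht
    · by_cases ht0 : t = []
      · rcases hv with rfl | rfl <;> simp [seriesCoef, ht0, hc.top_nil, hc.bottom_nil, h0]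
      · rcases hv with rfl | rfl <;> simp [seriesCoef, ht0, hc.top_of_ne, hc.bottom_of_ne]
  let e : (TopBottomGraph.series G).V → List ℕ → ℝ := Quotient.lift (seriesCoef h c) (by
    rintro ⟨k, v⟩ ⟨l, v'⟩ (hkl | ⟨hv, hv'⟩)
    · rw [hkl]
    · obtain rfl : v = v' := hv
      funext t
      by_cases ht : t = []
      · rw [ht]; rfl
      · rw [hends v k hv' t ht, hends v l hv' t ht])
  let i : ℕ → G.V → (TopBottomGraph.series G).V := fun k v => Quotient.mk _ (k, v)
  have he : ∀ k v t, e (i k v) t = seriesCoef h c (k, v) t := fun _ _ _ => rfl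
  have htop : ∀ k, (TopBottomGraph.series G).top = i k G.top := fun k =>
    Quotient.sound (Or.inr ⟨rfl, Or.inl rfl⟩)
  have hbot : ∀ k, (TopBottomGraph.series G).bottom = i k G.bottom := fun k =>
    Quotient.sound (Or.inr ⟨rfl, Or.inr rfl⟩)
  have hcases : ∀ z, ∃ k v, i k v = z := fun z => by
    induction z using Quotient.inductionOn with
    | _ z => exact ⟨z.1, z.2, rfl⟩
  have hi := fun k => dist_map_le (H := (TopBottomGraph.series G).graph) hc.connected (i k)
    fun u v huv => or_iff_not_imp_left.2 fun hne => ⟨hne, (k, u), (k, v), ⟨rfl, huv⟩, rfl, rfl⟩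
  have hii : ∀ k u v, ((TopBottomGraph.series G).graph.dist (i k u) (i k v) : ℝ) ≤
      G.graph.dist u v := fun k u v => by exact_mod_cast (hi k u v).2
  have hdb : ∀ k v, ((TopBottomGraph.series G).graph.dist (i k v)
      (TopBottomGraph.series G).bottom : ℝ) ≤ c v [] := fun k v => by
    rw [hbot k]
    exact (hii k v _).trans (hc.dist_bottom v)
  have hdt : ∀ k v, ((TopBottomGraph.series G).graph.dist (i k v)
      (TopBottomGraph.series G).top : ℝ) ≤ h - c v [] := fun k v => by
    rw [htop k]
    exact (hii k v _).trans (hc.dist_top v)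
  have hconn : (TopBottomGraph.series G).graph.Connected := by
    refine SimpleGraph.connected_iff_exists_forall_reachable _ |>.2
      ⟨(TopBottomGraph.series G).top, fun z => ?_⟩
    obtain ⟨k, v, rfl⟩ := hcases z
    rw [htop k]
    exact (hi k _ _).1
  have htri : ∀ x y z, ((TopBottomGraph.series G).graph.dist x y : ℝ) ≤
      (TopBottomGraph.series G).graph.dist x z + (TopBottomGraph.series G).graph.dist y z := by
    intro x y z
    rw [SimpleGraph.dist_comm (u := y)]
    exact_mod_cast hconn.dist_triangle
  refine ⟨e,
    { connected := hconn
      top_nil := hc.top_nil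
      bottom_nil := hc.bottom_nil
      top_of_ne := hends _ 0 (Or.inl rfl)
      bottom_of_ne := hends _ 0 (Or.inr rfl)
      dist_bottom := fun z => ?_
      dist_top := fun z => ?_
      support := fun z => ?_
      adj := ?_
      dist_le := fun z z' => ?_ }⟩
  · obtain ⟨k, v, rfl⟩ := hcases z
    exact hdb k v
  · obtain ⟨k, v, rfl⟩ := hcases z
    exact hdt k v
  · obtain ⟨k, v, rfl⟩ := hcases z
    obtain ⟨s, hs, hst⟩ := hc.support v
    refine ⟨k :: s, by simpa using hs, ?_⟩
    rintro (_ | ⟨j, t⟩) ht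
    · exact List.nil_prefix
    · rw [he, seriesCoef] at ht
      by_cases hj : j = k
      · subst hj
        rw [List.cons_prefix_cons]
        refine ⟨rfl, ?_⟩
        by_cases ht0 : t = []
        · exact ht0 ▸ List.nil_prefix
        · exact hst t (by simpa [ht0] using ht)
      · simp [hj] at ht
  · rintro z z' ⟨-, ⟨k, u⟩, ⟨l, v⟩, ⟨hkl, huv⟩, rfl, rfl⟩
    obtain rfl : k = l := hkl
    obtain ⟨s, hs, hst⟩ := hc.adj u v huv
    refine ⟨k :: s, by simpa using hs, fun t => ?_⟩
    change |seriesCoef h c (k, u) t - seriesCoef h c (k, v) t| ≤ 1 ∧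
      (seriesCoef h c (k, u) t ≠ seriesCoef h c (k, v) t → _)
    rcases t with _ | ⟨j, t⟩
    · exact ⟨(hst []).1, fun _ => List.nil_prefix⟩
    by_cases hj : j = k
    · subst hj
      rw [List.cons_prefix_cons]
      by_cases ht0 : t = []
      · subst ht0
        refine ⟨?_, fun _ => ⟨rfl, List.nil_prefix⟩⟩
        simpa [seriesCoef] using (abs_min_sub_min_le h _ _).trans (hst []).1
      · simpa [seriesCoef, ht0] using hst t
    · simp [seriesCoef, hj]
  · obtain ⟨k, u, rfl⟩ := hcases z
    obtain ⟨l, v, rfl⟩ := hcases z'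
    by_cases hkl : k = l
    · subst hkl
      obtain ⟨t, ht, htd⟩ := hc.dist_le u v
      by_cases ht0 : t = []
      · subst ht0
        exact ⟨[], Nat.zero_le _, (hii k u v).trans htd⟩
      · refine ⟨k :: t, by simpa using ht, (hii k u v).trans ?_⟩
        simpa [he, seriesCoef, ht0] using htd
    · by_contra! hcon
      have c0 := hcon [] (by simp)
      have c1 := hcon [k] (by simp)
      have c2 := hcon [l] (by simp)
      have m1 : 0 ≤ min (c u []) (h - c u []) :=
        le_min (hc.nonneg u) (sub_nonneg.2 (hc.le u))
      have m2 : 0 ≤ min (c v []) (h - c v []) :=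
        le_min (hc.nonneg v) (sub_nonneg.2 (hc.le v))
      simp only [he, seriesCoef, if_true, if_neg hkl, if_neg (Ne.symm hkl), sub_zero, zero_sub,
        abs_neg, abs_of_nonneg m1, abs_of_nonneg m2] at c0 c1 c2
      have d1 := htri (i k u) (i l v) (TopBottomGraph.series G).bottom
      have d2 := htri (i k u) (i l v) (TopBottomGraph.series G).top
      have d3 := hdb k u
      have d4 := hdb l v
      have d5 := hdt k u
      have d6 := hdt l v
      have a1 := le_abs_self (c u [] - c v [])
      have a2 := neg_abs_le (c u [] - c v [])
      rcases min_choice (c u []) (h - c u []) with h1 | h1 <;>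
      rcases min_choice (c v []) (h - c v []) with h2 | h2 <;>
      rw [h1] at c1 <;> rw [h2] at c2 <;> linarith

end IsCoding

/-! ### Embedding coded graphs into the dual space -/

theorem Construction.exists_isCoding (c : Construction) :
    ∃ h n e, IsCoding c.result h n e := by
  induction c with
  | path => exact ⟨_, _, IsCoding.path⟩
  | parallel c d ihc ihd =>
    obtain ⟨h, n, e, he⟩ := ihc
    obtain ⟨h', n', e', he'⟩ := ihd
    exact ⟨_, _, (he.mono (le_max_left n n')).parallel (he'.mono (le_max_right n n'))⟩
  | series c ih =>
    obtain ⟨h, n, e, he⟩ := ih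
    exact ⟨_, _, he.series⟩

theorem IsCoding.embedsWithDistortionLT {X : Type u} [NormedAddCommGroup X] [NormedSpace ℝ X]
    (hX : PropertyStar X) {G : TopBottomGraph.{v}} {h : ℝ} {n : ℕ} {c : G.V → List ℕ → ℝ}
    (hc : IsCoding G h n c) {ε : ℝ} (hε : 0 < ε) :
    G.EmbedsWithDistortionLT (StrongDual ℝ X) (6 + ε) := by
  obtain ⟨δ, hδ, hδ1, hδε⟩ : ∃ δ : ℝ, 0 < δ ∧ δ < 1 ∧ 6 * (1 + δ) < (6 + ε) * (1 - δ) :=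
    -- The inequality amounts to `δ < ε / (12 + ε)`.
    ⟨ε / (13 + ε), by positivity, by rw [div_lt_one (by positivity)]; linarith, by
      have : 0 < 13 + ε := by positivity
      rw [← mul_lt_mul_iff_left₀ this]
      have h1 : ε / (13 + ε) * (13 + ε) = ε := div_mul_cancel₀ _ this.ne'
      nlinarith⟩
  obtain ⟨x, hup, hlow⟩ := hX.exists_tree hδ n
  have hfin : ∀ v, (Function.support (c v)).Finite := fun v => by
    obtain ⟨s, -, hst⟩ := hc.support v
    refine s.inits.toFinset.finite_toSet.subset fun t ht => ?_
    rw [Finset.mem_coe, List.mem_toFinset, List.mem_inits]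
    exact hst t ht
  let C : G.V → List ℕ →₀ ℝ := fun v => Finsupp.ofSupportFinite (c v) (hfin v)
  let f : G.V → StrongDual ℝ X := fun v => Finsupp.linearCombination ℝ x (C v)
  have hf : ∀ u v, dist (f u) (f v) = ‖Finsupp.linearCombination ℝ x (C u - C v)‖ := fun u v => by
    rw [dist_eq_norm, map_sub]
  have hC : ∀ u v t, (C u - C v) t = c u t - c v t := fun _ _ _ => rfl
  -- The `6` combines the `3` of `IsCoding.dist_le` with the `2` of the coordinate bound. The upper
  -- constant need only be checked on edges, where the difference lies on one branch.
  refine ⟨f, (1 - δ) / 6, 1 + δ, by linarith, ?_, fun u v => ⟨?_, ?_⟩⟩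
  · rw [div_lt_iff₀ (by linarith)]
    linarith
  · obtain ⟨t, ht, htd⟩ := hc.dist_le u v
    have := hlow (C u - C v) t ht
    rw [hC, ← hf] at this
    nlinarith
  · have hwalk : ∀ {u v : G.V} (p : G.graph.Walk u v), dist (f u) (f v) ≤ (1 + δ) * p.length := by
      intro u v p
      induction p with
      | nil => simp
      | @cons u v w huv p ih =>
        obtain ⟨s, hs, hst⟩ := hc.adj u v huv
        have h1 := hup s hs (C u - C v) (fun t => (hst t).1) fun t ht =>
          (hst t).2 (sub_ne_zero.1 ht)
        rw [← hf] at h1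
        have h2 := dist_triangle (f u) (f v) (f w)
        rw [SimpleGraph.Walk.length_cons]
        push_cast
        linarith
    obtain ⟨p, hp⟩ := hc.connected.exists_walk_length_eq_dist u v
    rw [← hp]
    exact hwalk p

theorem EmbedsWithDistortionLT.of_iso {G : TopBottomGraph.{v}} {H : TopBottomGraph.{w}}
    (φ : Iso G H) (hH : H.graph.Connected) {E : Type*} [NormedAddCommGroup E] {D : ℝ}
    (h : H.EmbedsWithDistortionLT E D) : G.EmbedsWithDistortionLT E D := by
  obtain ⟨f, a, b, ha, hD, hf⟩ := h
  have hG : G.graph.Connected := φ.toIso.connected_iff.2 hH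
  have hdist : ∀ u v, H.graph.dist (φ.toIso u) (φ.toIso v) = G.graph.dist u v := fun u v => by
    refine le_antisymm
      (dist_map_le hG φ.toIso (fun _ _ h => Or.inr (φ.toIso.map_adj_iff.2 h)) u v).2 ?_
    have := (dist_map_le hH φ.toIso.symm
      (fun _ _ h => Or.inr (φ.toIso.symm.map_adj_iff.2 h)) (φ.toIso u) (φ.toIso v)).2
    simpa using this
  exact ⟨fun v => f (φ.toIso v), a, b, ha, hD, fun u v => by rw [← hdist]; exact hf _ _⟩

end TopBottomGraph

theorem mainTheorem5 (X : Type u) [NormedAddCommGroup X] [NormedSpace ℝ X] [CompleteSpace X]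
    [TopologicalSpace.SeparableSpace X] (hX : PropertyStar X) :
    (∀ n : ℕ, 1 ≤ n → InWeakStarAsymptoticStructure X (Pi.basisFun ℝ (Fin n))) ∧
    (∀ ε : ℝ, 0 < ε → ∀ G : TopBottomGraph.{v}, G.IsNontrivialCountablyBranchingBundleGraph →
      G.EmbedsWithDistortionLT (StrongDual ℝ X) (6 + ε)) := by
  refine ⟨fun n _ => hX.inWeakStarAsymptoticStructure n, ?_⟩
  rintro ε hε G ⟨c, -, ⟨φ⟩⟩
  obtain ⟨h, n, e, he⟩ := c.exists_isCoding
  exact .of_iso φ he.connected (he.embedsWithDistortionLT hX hε)
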